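/- Let $\mathbb{K}\in\{\mathbb{R},\mathbb{C}\}$, let $\mathcal{H}$ be a separable Hilbert space over $\mathbb{K}$, with inner product linear in its first argument, and let $\mathbb{K}^m$ carry an arbitrary norm. Let $\mathcal{A}:D(\mathcal{A})\subset\mathcal{H}\to\mathcal{H}$ and $\mathcal{B}:D(\mathcal{B})\subset\mathcal{H}\to\mathbb{K}^m$ be linear operators with $D(\mathcal{A})\subset D(\mathcal{B})$ such that $(\mathcal{A},\mathcal{B})$ is a boundary control system, i.e. 1. the operator $\mathcal{A}_0=\mathcal{A}|_{D(\mathcal{A}_0)}$ with $D(\mathcal{A}_0)=D(\mathcal{A})\cap\ker\mathcal{B}$ generates a $C_0$-semigroup $S$ on $\mathcal{H}$; 2. there is a lifting operator, i.e. a bounded operator $B:\mathbb{K}^m\to\mathcal{H}$ with $\mathrm{R}(B)\subset D(\mathcal{A})$, $\mathcal{A}B$ bounded, and $\mathcal{B}B=I_{\mathbb{K}^m}$. For $X_0\in D(\mathcal{A})$, $d\in\mathcal{C}^0(\mathbb{R}_+;\mathbb{K}^m)$, $U\in\mathcal{C}^0(\mathbb{R}_+;\mathcal{H})$ with $\mathcal{B}X_0=d(0)$,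 a classical solution associated with $(X_0,d,U)$ is a function $X\in\mathcal{C}^0(\mathbb{R}_+;D(\mathcal{A}))\cap\mathcal{C}^1(\mathbb{R}_+;\mathcal{H})$ ($D(\mathcal{A})$ with the graph norm) such that $X(0)=X_0$ and, for all $t\ge 0$, $\frac{\mathrm{d}X}{\mathrm{d}t}(t)=\mathcal{A}X(t)+U(t)$ and $\mathcal{B}X(t)=d(t)$. For $X_0\in\mathcal{H}$, $d\in\mathcal{C}^0(\mathbb{R}_+;\mathbb{K}^m)$, $U\in\mathcal{C}^0(\mathbb{R}_+;\mathcal{H})$, a weak solution associated with $(X_0,d,U)$ is a function $X\in\mathcal{C}^0(\mathbb{R}_+;\mathcal{H})$ such that for every $T>0$, every lifting operator $B$, and every $z\in\mathcal{C}^0([0,T];D(\mathcal{A}_0^*))\cap\mathcal{C}^1([0,T];\mathcal{H})$ with $\mathcal{A}_0^*z\in\mathcal{C}^0([0,T];\mathcal{H})$ and $z(T)=0$, $$\int_0^T\Big\langle X(t),\mathcal{A}_0^*z(t)+\frac{\mathrm{d}z}{\mathrm{d}t}(t)\Big\rangle\,\mathrm{d}t=-\langle X_0,z(0)\rangle+\int_0^T\langle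 Bd(t),\mathcal{A}_0^*z(t)\rangle\,\mathrm{d}t-\int_0^T\langle \mathcal{A}Bd(t),z(t)\rangle\,\mathrm{d}t-\int_0^T\langle U(t),z(t)\rangle\,\mathrm{d}t .$$ Let $\mathcal{K}$ be the set of continuous strictly increasing $\gamma:\mathbb{R}_+\to\mathbb{R}_+$ with $\gamma(0)=0$, and let $\mathcal{KL}$ be the set of continuous $\beta:\mathbb{R}_+\times\mathbb{R}_+\to\mathbb{R}_+$ such that $\beta(\cdot,t)\in\mathcal{K}$ for all $t\ge0$ and $\beta(x,\cdot)$ is strictly decreasing with limit $0$ at $+\infty$ for all $x>0$. Assume that there are $\beta\in\mathcal{KL}$ and $\gamma_1,\gamma_2\in\mathcal{K}$ such that for all $X_0\in D(\mathcal{A})$, $d\in\mathcal{C}^2(\mathbb{R}_+;\mathbb{K}^m)$, $U\in\mathcal{C}^1(\mathbb{R}_+;\mathcal{H})$ with $\mathcal{B}X_0=d(0)$, the classical solution $X$ associated with $(X_0,d,U)$ satisfies, for all $t\ge0$, $$\|X(t)\|\le\beta(\|X_0\|,t)+\gamma_1\Big(\sup_{s\in[0,t]}\|d(s)\|\Big)+\gamma_2\Big(\sup_{s\in[0,t]}\|U(s)\|\Big).$$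 **Theorem.** Let $X_0\in\mathcal{H}$, $d\in\mathcal{C}^1(\mathbb{R}_+;\mathbb{K}^m)$ and $U\in\mathcal{C}^0(\mathbb{R}_+;\mathcal{H})$. Then a weak solution associated with $(X_0,d,U)$ exists, and every weak solution $X$ associated with $(X_0,d,U)$ satisfies, for every lifting operator $B$ and all $t\ge0$, $$X(t)=S(t)(X_0-Bd(0))+Bd(t)+\int_0^tS(t-\tau)\big\{-B\dot d(\tau)+\mathcal{A}Bd(\tau)+U(\tau)\big\}\,\mathrm{d}\tau .$$ In particular the weak solution is unique and coincides with the mild solution. -/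

import Mathlib

open Set Filter Topology

noncomputable section

namespace BoundaryControl

/-! Comparison functions on the half-line `[0, ∞)`. -/

/-- Class `𝒦`: continuous, strictly increasing functions `ℝ₊ → ℝ₊` vanishing at `0`. -/
structure ClassK (γ : ℝ → ℝ) : Prop where
  mapsTo : MapsTo γ (Ici 0) (Ici 0)
  continuousOn : ContinuousOn γ (Ici 0)
  strictMonoOn : StrictMonoOn γ (Ici 0)
  map_zero : γ 0 = 0

/-- Class `ℒ`: continuous, strictly decreasing functions `ℝ₊ → ℝ₊` tending to `0` at infinity. -/
structure ClassL (γ : ℝ → ℝ) : Prop where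
  mapsTo : MapsTo γ (Ici 0) (Ici 0)
  continuousOn : ContinuousOn γ (Ici 0)
  strictAntiOn : StrictAntiOn γ (Ici 0)
  tendsto_zero : Tendsto γ atTop (𝓝 0)

/-- Class `𝒦ℒ`: continuous functions `β : ℝ₊ × ℝ₊ → ℝ₊` with `β(·, t) ∈ 𝒦` for `t ≥ 0` and
`β(x, ·) ∈ ℒ` for `x > 0`. -/
structure ClassKL (β : ℝ → ℝ → ℝ) : Prop where
  continuousOn : ContinuousOn (fun p : ℝ × ℝ => β p.1 p.2) (Ici 0 ×ˢ Ici 0)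
  classK : ∀ t, 0 ≤ t → ClassK (fun x => β x t)
  classL : ∀ x, 0 < x → ClassL (fun t => β x t)

/-- The norm `‖f‖_{C⁰([0,t];E)} = sup_{s ∈ [0,t]} ‖f s‖` (used for continuous `f` and `t ≥ 0`). -/
def supNorm {E : Type*} [NormedAddCommGroup E] (f : ℝ → E) (t : ℝ) : ℝ :=
  ⨆ s : Icc (0 : ℝ) t, ‖f s‖

section

variable {𝕜 H V : Type*} [RCLike 𝕜]
  [NormedAddCommGroup H] [InnerProductSpace 𝕜 H]
  [NormedAddCommGroup V] [NormedSpace 𝕜 V]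

/-- `S` restricted to `[0, ∞)` is a `C₀`-semigroup of bounded operators on `H`
(the values of `S` at negative times are irrelevant). -/
structure IsC0Semigroup (S : ℝ → H →L[𝕜] H) : Prop where
  map_zero : S 0 = ContinuousLinearMap.id 𝕜 H
  map_add : ∀ s t, 0 ≤ s → 0 ≤ t → S (s + t) = (S s).comp (S t)
  tendsto_zero : ∀ x, Tendsto (fun t => S t x) (𝓝[>] 0) (𝓝 x)

/-- The unbounded operator `G` (with its domain) is the infinitesimal generator of `S`:
`x ∈ D(G)` and `G x = y` iff `(S(h) x - x) / h → y` as `h → 0⁺`. -/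
def IsGenerator (G : H →ₗ.[𝕜] H) (S : ℝ → H →L[𝕜] H) : Prop :=
  ∀ x y : H, (x, y) ∈ G.graph ↔
    Tendsto (fun h : ℝ => ((h⁻¹ : ℝ) : 𝕜) • (S h x - x)) (𝓝[>] 0) (𝓝 y)

/-- The disturbance free operator `𝒜₀`: the restriction of `𝒜` to `D(𝒜) ∩ ker ℬ`. -/
def disturbanceFree (A : H →ₗ.[𝕜] H) (Bd : H →ₗ.[𝕜] V) : H →ₗ.[𝕜] H :=
  A.domRestrict ((LinearMap.ker Bd.toFun).map Bd.domain.subtype)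

theorem mem_disturbanceFree_graph (A : H →ₗ.[𝕜] H) (Bd : H →ₗ.[𝕜] V) (x y : H) :
    (x, y) ∈ (disturbanceFree A Bd).graph ↔
      (x, y) ∈ A.graph ∧ ∃ h : x ∈ Bd.domain, Bd ⟨x, h⟩ = 0 := by
  simp only [LinearPMap.mem_graph_iff]
  constructor
  · rintro ⟨⟨a, ha⟩, rfl, rfl⟩
    have ha' := ha
    rw [disturbanceFree, LinearPMap.domRestrict_domain] at ha'
    obtain ⟨⟨b, hb, hab⟩, h2⟩ := ha'
    refine ⟨⟨⟨a, h2⟩, rfl, ?_⟩, ?_⟩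
    · exact (LinearPMap.domRestrict_apply rfl).symm
    · change b.1 = a at hab
      subst hab
      exact ⟨b.2, hb⟩
  · rintro ⟨⟨⟨a, ha⟩, rfl, rfl⟩, h, hb⟩
    have hm : a ∈ (disturbanceFree A Bd).domain := by
      rw [disturbanceFree, LinearPMap.domRestrict_domain]
      exact ⟨⟨⟨a, h⟩, hb, rfl⟩, ha⟩
    exact ⟨⟨a, hm⟩, rfl, LinearPMap.domRestrict_apply rfl⟩

/-- `B` is a lifting operator for `(𝒜, ℬ)`: a bounded operator with `R(B) ⊆ D(𝒜)`, `𝒜B` bounded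
and `ℬB = I`. -/
structure IsLiftingOperator (A : H →ₗ.[𝕜] H) (Bd : H →ₗ.[𝕜] V) (B : V →L[𝕜] H) : Prop where
  mem_domain : ∀ v, B v ∈ A.domain
  continuous_comp : Continuous fun v => A ⟨B v, mem_domain v⟩
  boundary_comp : ∀ v, ∃ h : B v ∈ Bd.domain, Bd ⟨B v, h⟩ = v

/-- `(𝒜, ℬ)` is a boundary control system. -/
structure IsBoundaryControlSystem (A : H →ₗ.[𝕜] H) (Bd : H →ₗ.[𝕜] V) : Prop where
  domain_le : A.domain ≤ Bd.domain
  exists_semigroup : ∃ S : ℝ → H →L[𝕜] H, IsC0Semigroup S ∧ IsGenerator (disturbanceFree A Bd) S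
  exists_lifting : ∃ B : V →L[𝕜] H, IsLiftingOperator A Bd B

variable [NormedSpace ℝ H]

/-- `X` is a classical solution of `dX/dt = 𝒜X + U`, `ℬX = d`, `X(0) = X₀` on `[0, ∞)`:
`X ∈ C⁰(ℝ₊; D(𝒜)) ∩ C¹(ℝ₊; H)`, where `D(𝒜)` carries the graph norm, i.e. `t ↦ 𝒜X(t)` is
continuous (this function is called `AX`). -/
structure IsClassicalSolution (A : H →ₗ.[𝕜] H) (Bd : H →ₗ.[𝕜] V) (X₀ : H) (d : ℝ → V)
    (U : ℝ → H) (X : ℝ → H) : Prop where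
  contDiffOn : ContDiffOn ℝ 1 X (Ici 0)
  initial : X 0 = X₀
  evolution : ∃ AX : ℝ → H, ContinuousOn AX (Ici 0) ∧ ∀ t, 0 ≤ t →
    (X t, AX t) ∈ A.graph ∧ derivWithin X (Ici 0) t = AX t + U t
  boundary : ∀ t, 0 ≤ t → ∃ h : X t ∈ Bd.domain, Bd ⟨X t, h⟩ = d t

variable [CompleteSpace H]

/-- `z` is a test function over `[0, T]` with respect to `𝒜₀ = G`, and `w = 𝒜₀* z` on `[0, T]`:
`z ∈ C⁰([0,T]; D(𝒜₀*)) ∩ C¹([0,T]; H)`, `𝒜₀* z ∈ C⁰([0,T]; H)`, `z(T) = 0`. -/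
structure IsTestFunction (G : H →ₗ.[𝕜] H) (T : ℝ) (z w : ℝ → H) : Prop where
  contDiffOn : ContDiffOn ℝ 1 z (Icc 0 T)
  mem_graph : ∀ t ∈ Icc 0 T, (z t, w t) ∈ G.adjoint.graph
  continuousOn : ContinuousOn w (Icc 0 T)
  terminal : z T = 0

/-- `X` is a weak solution associated with `(X₀, d, U)`. Mathlib's `inner 𝕜 a b` is linear in the
second argument, so the mathematical `⟨a, b⟩` (linear in the first one) is `inner 𝕜 b a`. The
function `w` is `𝒜₀* z`, and `B` is an arbitrary lifting operator. -/
structure IsWeakSolution (A : H →ₗ.[𝕜] H) (Bd : H →ₗ.[𝕜] V) (X₀ : H) (d : ℝ → V)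
    (U : ℝ → H) (X : ℝ → H) : Prop where
  continuousOn : ContinuousOn X (Ici 0)
  weak_eq : ∀ (B : V →L[𝕜] H) (hB : IsLiftingOperator A Bd B) (T : ℝ), 0 < T →
    ∀ z w : ℝ → H, IsTestFunction (disturbanceFree A Bd) T z w →
      ∫ t in (0 : ℝ)..T, inner 𝕜 (w t + derivWithin z (Icc 0 T) t) (X t) =
        - inner 𝕜 (z 0) X₀
        + (∫ t in (0 : ℝ)..T, inner 𝕜 (w t) (B (d t)))
        - (∫ t in (0 : ℝ)..T, inner 𝕜 (z t) (A ⟨B (d t), hB.mem_domain (d t)⟩))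
        - (∫ t in (0 : ℝ)..T, inner 𝕜 (z t) (U t))

end

section

variable {𝕜 H V : Type*} [RCLike 𝕜]
  [NormedAddCommGroup H] [InnerProductSpace 𝕜 H] [NormedSpace ℝ H]
  [NormedAddCommGroup V] [NormedSpace 𝕜 V] [NormedSpace ℝ V]

/-- The mild solution
`S(t)(X₀ - B d(0)) + B d(t) + ∫₀ᵗ S(t-τ) {-B ḋ(τ) + 𝒜B d(τ) + U(τ)} dτ`. -/
def mildSolution {A : H →ₗ.[𝕜] H} {Bd : H →ₗ.[𝕜] V} {B : V →L[𝕜] H}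
    (hB : IsLiftingOperator A Bd B) (S : ℝ → H →L[𝕜] H) (X₀ : H) (d : ℝ → V) (U : ℝ → H)
    (t : ℝ) : H :=
  S t (X₀ - B (d 0)) + B (d t) +
    ∫ τ in (0 : ℝ)..t, S (t - τ)
      (-B (derivWithin d (Ici 0) τ) + A ⟨B (d τ), hB.mem_domain (d τ)⟩ + U τ)

/-- The estimate `‖X(t)‖ ≤ β(‖X₀‖, t) + γ₁(‖d‖_{C⁰([0,t])}) + γ₂(‖U‖_{C⁰([0,t])})`, `t ≥ 0`,
for all classical solutions with `X₀ ∈ D(𝒜)`, `d ∈ C²`, `U ∈ C¹` and `ℬX₀ = d(0)`. -/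
def ClassicalISSEstimate (A : H →ₗ.[𝕜] H) (Bd : H →ₗ.[𝕜] V)
    (β : ℝ → ℝ → ℝ) (γ₁ γ₂ : ℝ → ℝ) : Prop :=
  ∀ (X₀ : H) (d : ℝ → V) (U : ℝ → H),
    X₀ ∈ A.domain → ContDiffOn ℝ 2 d (Ici 0) → ContDiffOn ℝ 1 U (Ici 0) →
    (∃ h : X₀ ∈ Bd.domain, Bd ⟨X₀, h⟩ = d 0) →
    ∀ X : ℝ → H, IsClassicalSolution A Bd X₀ d U X →
      ∀ t, 0 ≤ t → ‖X t‖ ≤ β ‖X₀‖ t + γ₁ (supNorm d t) + γ₂ (supNorm U t)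

end

end BoundaryControl

end

/-! Existence comes from checking that the mild solution `X` is a weak solution. `X` need not enter
`D(𝒜)`, but for `y ∈ D(𝒜₀*)` the scalar function `⟨X, y⟩` is right differentiable: the increments of
`X - Bd` contain `S(h)x - x = 𝒜₀ ∫₀ʰ S(s)x ds`, and the adjoint moves `𝒜₀` onto `y`. A product rule
gives the right derivative of `⟨X, z⟩` for a test function `z`, and integrating it over `[0, T]` is
the weak identity.

For uniqueness, the difference `Y` of two weak solutions annihilates all test functions. Testing
with `z = φ(t) y` for a well-chosen scalar `φ` gives `⟨Y(T), y⟩ = ⟨∫₀ᵀ Y, 𝒜₀* y⟩`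
(`inner_eq_integral_of_weak`). Since `𝒜₀` is closed and densely defined, `𝒜₀** = 𝒜₀`, so `Z(T) = ∫₀ᵀ
Y` lies in `D(𝒜₀)` with `𝒜₀ Z = Y = Z'` and `Z(0) = 0`. Uniqueness for this Cauchy problem gives `Z
= 0`, hence `Y = 𝒜₀ Z = 0`.

Only right derivatives of semigroup orbits are used; the fundamental theorem of calculus for
continuous functions with an integrable right derivative suffices. Since `S` is constrained only on
`[0, ∞)`, it is evaluated at `max t 0`, which makes orbits continuous on all of `ℝ`. -/

namespace BoundaryControl

/-! ### Right derivatives and averages over shrinking intervals. -/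

section Calculus

variable {E : Type*} [NormedAddCommGroup E] [NormedSpace ℝ E]

theorem tendsto_const_add_nhdsGT (t : ℝ) :
    Tendsto (fun h : ℝ => t + h) (𝓝[>] 0) (𝓝[>] t) := by
  refine tendsto_nhdsWithin_iff.2 ⟨?_, ?_⟩
  · have : Tendsto (fun h : ℝ => t + h) (𝓝 0) (𝓝 (t + 0)) :=
      (continuous_const.add continuous_id).tendsto _
    rw [add_zero] at this
    exact this.mono_left nhdsWithin_le_nhds
  · filter_upwards [self_mem_nhdsWithin] with h hh
    simpa using hh

theorem hasDerivWithinAt_Ioi_iff_tendsto {f : ℝ → E} {f' : E} {t : ℝ} :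
    HasDerivWithinAt f f' (Ioi t) t ↔
      Tendsto (fun h : ℝ => h⁻¹ • (f (t + h) - f t)) (𝓝[>] 0) (𝓝 f') := by
  rw [hasDerivWithinAt_iff_tendsto_slope' self_notMem_Ioi]
  have h2 : Tendsto (fun s : ℝ => s - t) (𝓝[>] t) (𝓝[>] 0) := by
    refine tendsto_nhdsWithin_iff.2 ⟨?_, ?_⟩
    · have : Tendsto (fun s : ℝ => s - t) (𝓝 t) (𝓝 (t - t)) :=
        (continuous_id.sub continuous_const).tendsto _
      rw [sub_self] at this
      exact this.mono_left nhdsWithin_le_nhds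
    · filter_upwards [self_mem_nhdsWithin] with s hs
      simpa using hs
  constructor
  · intro h
    refine (h.comp (tendsto_const_add_nhdsGT t)).congr fun s => ?_
    simp [slope_def_module]
  · intro h
    refine (h.comp h2).congr fun s => ?_
    simp [slope_def_module]

/-- The integrand may depend on `h` as well, as needed for the Duhamel increments `∫₀ʰ S(h - r) f(t
+ r) dr`. -/
theorem tendsto_average_of_continuous [CompleteSpace E] {k : ℝ × ℝ → E} (hk : Continuous k) :
    Tendsto (fun h : ℝ => h⁻¹ • ∫ r in (0 : ℝ)..h, k (h, r)) (𝓝[>] 0) (𝓝 (k (0, 0))) := by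
  rw [Metric.tendsto_nhds]
  intro ε hε
  obtain ⟨δ, hδ, H⟩ := Metric.continuousAt_iff.1 hk.continuousAt (ε / 2) (half_pos hε)
  filter_upwards [Ioo_mem_nhdsGT hδ] with h hh
  have hpos : 0 < h := hh.1
  have e1 : h⁻¹ • (∫ r in (0 : ℝ)..h, k (h, r)) - k (0, 0) =
      h⁻¹ • ∫ r in (0 : ℝ)..h, (k (h, r) - k (0, 0)) := by
    rw [intervalIntegral.integral_sub, intervalIntegral.integral_const, smul_sub, sub_zero,
      smul_smul, inv_mul_cancel₀ hpos.ne', one_smul]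
    · exact (hk.comp (by fun_prop)).intervalIntegrable _ _
    · exact intervalIntegrable_const
  have e2 : ‖∫ r in (0 : ℝ)..h, (k (h, r) - k (0, 0))‖ ≤ ε / 2 * |h - 0| := by
    refine intervalIntegral.norm_integral_le_of_norm_le_const fun r hr => ?_
    rw [uIoc_of_le hpos.le] at hr
    rw [← dist_eq_norm]
    refine (H ?_).le
    rw [Prod.dist_eq, max_lt_iff]
    simp only [Real.dist_eq, sub_zero]
    rw [abs_of_pos hpos, abs_of_pos hr.1]
    exact ⟨hh.2, hr.2.trans_lt hh.2⟩
  rw [dist_eq_norm, e1, norm_smul, norm_inv, Real.norm_eq_abs, abs_of_pos hpos]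
  rw [sub_zero, abs_of_pos hpos] at e2
  calc h⁻¹ * _ ≤ h⁻¹ * (ε / 2 * h) := by gcongr
    _ = ε / 2 := by field_simp
    _ < ε := half_lt_self hε

end Calculus

/-! ### Local boundedness and joint continuity of a `C₀`-semigroup. -/

section Semigroup

variable {𝕜 H : Type*} [RCLike 𝕜] [NormedAddCommGroup H] [InnerProductSpace 𝕜 H]
  {S : ℝ → H →L[𝕜] H}

theorem IsC0Semigroup.apply_zero (hS : IsC0Semigroup S) (x : H) : S 0 x = x := by
  rw [hS.map_zero]; rfl

theorem IsC0Semigroup.apply_add (hS : IsC0Semigroup S) {s t : ℝ} (hs : 0 ≤ s) (ht : 0 ≤ t)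
    (x : H) : S (s + t) x = S s (S t x) := by
  rw [hS.map_add s t hs ht]; rfl

theorem IsC0Semigroup.tendsto_zero_Ici (hS : IsC0Semigroup S) (x : H) :
    Tendsto (fun t => S t x) (𝓝[≥] 0) (𝓝 x) := by
  have : ContinuousWithinAt (fun t => S t x) (Ioi 0) 0 := by
    rw [ContinuousWithinAt, hS.apply_zero]
    exact hS.tendsto_zero x
  have h2 := continuousWithinAt_Ioi_iff_Ici.1 this
  rwa [ContinuousWithinAt, hS.apply_zero] at h2

theorem IsC0Semigroup.norm_sub_le (hS : IsC0Semigroup S) {T M : ℝ}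
    (hM : ∀ t ∈ Icc (0 : ℝ) T, ‖S t‖ ≤ M) {s t : ℝ} (hs : s ∈ Icc 0 T) (ht : t ∈ Icc 0 T) (x : H) :
    ‖S t x - S s x‖ ≤ M * ‖S |t - s| x - x‖ := by
  wlog h : s ≤ t generalizing s t
  · rw [norm_sub_rev, abs_sub_comm]
    exact this ht hs (le_of_not_ge h)
  have e : S t x = S s (S (t - s) x) := by
    rw [← hS.apply_add hs.1 (sub_nonneg.2 h)]; congr 2; ring
  rw [abs_of_nonneg (sub_nonneg.2 h), e, ← map_sub]
  exact (S s).le_of_opNorm_le (hM s hs) _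

variable [CompleteSpace H]

/-- Otherwise `‖S(tₙ)‖ > n` along some `tₙ → 0`, while every orbit `S(tₙ)x` converges and so is
bounded; this contradicts Banach–Steinhaus. -/
theorem IsC0Semigroup.exists_bound_near_zero (hS : IsC0Semigroup S) :
    ∃ δ > 0, ∃ M, ∀ t ∈ Icc (0 : ℝ) δ, ‖S t‖ ≤ M := by
  by_contra! hcon
  have h1 : ∀ n : ℕ, ∃ t ∈ Icc (0 : ℝ) (1 / ((n : ℝ) + 1)), (n : ℝ) < ‖S t‖ := fun n =>
    hcon _ (by positivity) n
  choose t ht hn using h1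
  have ht0 : Tendsto t atTop (𝓝[≥] 0) := by
    refine tendsto_nhdsWithin_iff.2 ⟨?_, Eventually.of_forall fun n => (ht n).1⟩
    exact squeeze_zero (fun n => (ht n).1) (fun n => (ht n).2)
      tendsto_one_div_add_atTop_nhds_zero_nat
  obtain ⟨C, hC⟩ := banach_steinhaus (g := fun n => S (t n)) fun x => by
    obtain ⟨C, hC⟩ := (((hS.tendsto_zero_Ici x).comp ht0).norm).bddAbove_range
    exact ⟨C, fun n => hC ⟨n, rfl⟩⟩
  obtain ⟨n, hn'⟩ := exists_nat_gt C
  exact absurd (hC n) (not_le.2 (hn'.trans (hn n)))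

theorem IsC0Semigroup.exists_bound (hS : IsC0Semigroup S) (T : ℝ) :
    ∃ M, ∀ t ∈ Icc (0 : ℝ) T, ‖S t‖ ≤ M := by
  obtain ⟨δ, hδ, M, hM⟩ := hS.exists_bound_near_zero
  have key : ∀ n : ℕ, ∃ C, ∀ t ∈ Icc (0 : ℝ) (n * δ), ‖S t‖ ≤ C := by
    intro n
    induction n with
    | zero =>
      refine ⟨M, fun t ht => hM t ⟨ht.1, ht.2.trans ?_⟩⟩
      simpa using hδ.le
    | succ n ih =>
      obtain ⟨C, hC⟩ := ih
      refine ⟨max M (M * C), fun t ht => ?_⟩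
      rcases le_total t δ with h | h
      · exact (hM t ⟨ht.1, h⟩).trans (le_max_left _ _)
      · refine le_trans ?_ (le_max_right _ _)
        have ht2 := ht.2
        push_cast at ht2
        -- Peeling off one step of length `δ` costs a factor `M`.
        have e : S t = (S δ).comp (S (t - δ)) := by
          rw [← hS.map_add _ _ hδ.le (sub_nonneg.2 h)]; congr 1; ring
        rw [e]
        refine (ContinuousLinearMap.opNorm_comp_le _ _).trans ?_
        have h1 := hM δ ⟨hδ.le, le_rfl⟩
        have h2 := hC (t - δ) ⟨sub_nonneg.2 h, by linarith⟩
        exact mul_le_mul h1 h2 (norm_nonneg _) ((norm_nonneg _).trans h1)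
  obtain ⟨n, hn⟩ := exists_nat_ge (T / δ)
  obtain ⟨C, hC⟩ := key n
  exact ⟨C, fun t ht => hC t ⟨ht.1, ht.2.trans ((div_le_iff₀ hδ).1 hn)⟩⟩

theorem IsC0Semigroup.continuous_apply (hS : IsC0Semigroup S) (x : H) :
    Continuous fun s : ℝ => S (max s 0) x := by
  rw [continuous_iff_continuousAt]
  intro s₀
  obtain ⟨M, hM⟩ := hS.exists_bound (max s₀ 0 + 1)
  rw [ContinuousAt, tendsto_iff_norm_sub_tendsto_zero]
  have hlim : Tendsto (fun s : ℝ => |max s 0 - max s₀ 0|) (𝓝 s₀) (𝓝[≥] 0) := by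
    refine tendsto_nhdsWithin_iff.2 ⟨?_, Eventually.of_forall fun s => mem_Ici.2 (abs_nonneg _)⟩
    have : Continuous fun s : ℝ => |max s 0 - max s₀ 0| := by fun_prop
    simpa using this.tendsto s₀
  have h2 : Tendsto (fun s : ℝ => M * ‖S |max s 0 - max s₀ 0| x - x‖) (𝓝 s₀) (𝓝 0) := by
    have := (((hS.tendsto_zero_Ici x).comp hlim).sub_const x).norm.const_mul M
    simpa using this
  refine squeeze_zero' (Eventually.of_forall fun _ => norm_nonneg _) ?_ h2
  have hev : ∀ᶠ s : ℝ in 𝓝 s₀, max s 0 < max s₀ 0 + 1 :=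
    (by fun_prop : Continuous fun s : ℝ => max s 0).continuousAt.eventually_lt
      continuousAt_const (by linarith)
  filter_upwards [hev] with s hs
  exact hS.norm_sub_le hM ⟨le_max_right _ _, by linarith⟩ ⟨le_max_right _ _, hs.le⟩ x

/-- Strong continuity upgrades to joint continuity because `‖S‖` is locally bounded. -/
theorem IsC0Semigroup.continuous_uncurry (hS : IsC0Semigroup S) :
    Continuous fun p : ℝ × H => S (max p.1 0) p.2 := by
  rw [continuous_iff_continuousAt]
  rintro ⟨s₀, v₀⟩
  obtain ⟨M, hM⟩ := hS.exists_bound (max s₀ 0 + 1)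
  rw [ContinuousAt, tendsto_iff_norm_sub_tendsto_zero]
  have h2 : Tendsto (fun p : ℝ × H => M * ‖p.2 - v₀‖ +
      ‖S (max p.1 0) v₀ - S (max s₀ 0) v₀‖) (𝓝 (s₀, v₀)) (𝓝 0) := by
    have : Continuous fun p : ℝ × H => M * ‖p.2 - v₀‖ +
        ‖S (max p.1 0) v₀ - S (max s₀ 0) v₀‖ :=
      (continuous_const.mul (continuous_snd.sub continuous_const).norm).add
        (((hS.continuous_apply v₀).comp continuous_fst).sub continuous_const).norm
    simpa using this.tendsto (s₀, v₀)
  refine squeeze_zero' (Eventually.of_forall fun _ => norm_nonneg _) ?_ h2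
  have hev : ∀ᶠ p : ℝ × H in 𝓝 (s₀, v₀), max p.1 0 < max s₀ 0 + 1 :=
    (by fun_prop : Continuous fun p : ℝ × H => max p.1 0).continuousAt.eventually_lt
      continuousAt_const (by simp)
  filter_upwards [hev] with p hp
  have e : S (max p.1 0) p.2 - S (max s₀ 0) v₀ =
      S (max p.1 0) (p.2 - v₀) + (S (max p.1 0) v₀ - S (max s₀ 0) v₀) := by
    rw [map_sub]; abel
  rw [e]
  refine (norm_add_le _ _).trans (add_le_add_left ?_ _)
  exact (S _).le_of_opNorm_le (hM _ ⟨le_max_right _ _, hp.le⟩) _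

theorem IsC0Semigroup.continuous_comp (hS : IsC0Semigroup S) {α : Type*} [TopologicalSpace α]
    {a : α → ℝ} {v : α → H} (ha : Continuous a) (hv : Continuous v) :
    Continuous fun p => S (max (a p) 0) (v p) :=
  hS.continuous_uncurry.comp (ha.prodMk hv)

end Semigroup

/-! ### The generator: density of its domain and closedness of its graph. -/

section Generator

variable {𝕜 H : Type*} [RCLike 𝕜] [NormedAddCommGroup H] [InnerProductSpace 𝕜 H]
  [NormedSpace ℝ H] [IsScalarTower ℝ 𝕜 H] {S : ℝ → H →L[𝕜] H} {G : H →ₗ.[𝕜] H}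

/-- The real structure is a separate instance tied to `𝕜` only by the scalar tower, so real scalars
have to pass through `algebraMap`. -/
theorem map_real_smul_clm {F : Type*} [NormedAddCommGroup F] [NormedSpace 𝕜 F] [NormedSpace ℝ F]
    [IsScalarTower ℝ 𝕜 F] (L : H →L[𝕜] F) (r : ℝ) (x : H) : L (r • x) = r • L x := by
  rw [← algebraMap_smul 𝕜 r x, map_smul, algebraMap_smul]

theorem IsGenerator.mem_graph_iff (hG : IsGenerator G S) {x y : H} :
    (x, y) ∈ G.graph ↔ Tendsto (fun h : ℝ => h⁻¹ • (S h x - x)) (𝓝[>] 0) (𝓝 y) := by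
  rw [hG x y]
  refine iff_of_eq (congrArg (fun f => Tendsto f _ _) (funext fun h => ?_))
  exact algebraMap_smul 𝕜 h⁻¹ (S h x - x)

variable [CompleteSpace H]

/-- Applying `S(h)` shifts the integral, so the difference quotient is the average of the orbit over
`[t, t + h]` minus its average over `[0, h]`. -/
theorem IsC0Semigroup.integral_mem_graph (hS : IsC0Semigroup S) (hG : IsGenerator G S) {t : ℝ}
    (ht : 0 ≤ t) (x : H) :
    (∫ s in (0 : ℝ)..t, S (max s 0) x, S t x - x) ∈ G.graph := by
  rw [hG.mem_graph_iff]
  have hc := hS.continuous_apply x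
  have hi : ∀ a b, IntervalIntegrable (fun s : ℝ => S (max s 0) x) MeasureTheory.volume a b :=
    fun a b => hc.intervalIntegrable a b
  have h1 := tendsto_average_of_continuous (k := fun p : ℝ × ℝ => S (max (t + p.2) 0) x)
    (hc.comp (by fun_prop))
  have h2 := tendsto_average_of_continuous (k := fun p : ℝ × ℝ => S (max p.2 0) x)
    (hc.comp (by fun_prop))
  simp only [add_zero, max_eq_left ht, max_self, hS.apply_zero] at h1 h2
  refine (h1.sub h2).congr' ?_
  filter_upwards [self_mem_nhdsWithin] with h hh
  have hh : 0 ≤ h := (mem_Ioi.1 hh).le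
  rw [← smul_sub]
  congr 1
  have e1 : S h (∫ s in (0 : ℝ)..t, S (max s 0) x) = ∫ s in h..(t + h), S (max s 0) x := by
    have := (S h).intervalIntegral_comp_comm (hi 0 t)
    rw [← this]
    have e : ∫ s in (0 : ℝ)..t, S h (S (max s 0) x) =
        ∫ s in (0 : ℝ)..t, S (max (s + h) 0) x := by
      refine intervalIntegral.integral_congr fun s hs => ?_
      rw [uIcc_of_le ht] at hs
      rw [max_eq_left hs.1, max_eq_left (add_nonneg hs.1 hh), add_comm, hS.apply_add hh hs.1]
    rw [e, intervalIntegral.integral_comp_add_right (fun s => S (max s 0) x), zero_add]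
  have e2 : ∫ r in (0 : ℝ)..h, S (max (t + r) 0) x = ∫ s in t..(t + h), S (max s 0) x := by
    rw [intervalIntegral.integral_comp_add_left (fun s => S (max s 0) x), add_zero]
  have e3 := intervalIntegral.integral_add_adjacent_intervals (hi 0 t) (hi t (t + h))
  have e4 := intervalIntegral.integral_add_adjacent_intervals (hi 0 h) (hi h (t + h))
  rw [e1, e2, sub_eq_sub_iff_add_eq_add]
  exact (add_comm _ _).trans (e3.trans (e4.symm.trans (add_comm _ _)))

omit [IsScalarTower ℝ 𝕜 H] in
theorem IsC0Semigroup.tendsto_average (hS : IsC0Semigroup S) (x : H) :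
    Tendsto (fun h : ℝ => h⁻¹ • ∫ s in (0 : ℝ)..h, S (max s 0) x) (𝓝[>] 0) (𝓝 x) := by
  have h2 := tendsto_average_of_continuous (k := fun p : ℝ × ℝ => S (max p.2 0) x)
    ((hS.continuous_apply x).comp (by fun_prop))
  simpa only [max_self, hS.apply_zero] using h2

theorem IsC0Semigroup.dense_domain (hS : IsC0Semigroup S) (hG : IsGenerator G S) :
    Dense (G.domain : Set H) := by
  intro x
  refine mem_closure_of_tendsto (hS.tendsto_average x) ?_
  filter_upwards [self_mem_nhdsWithin] with h hh
  have hm := LinearPMap.mem_domain_of_mem_graph (hS.integral_mem_graph hG (mem_Ioi.1 hh).le x)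
  rw [← algebraMap_smul 𝕜]
  exact G.domain.smul_mem _ hm

omit [CompleteSpace H] in
theorem IsC0Semigroup.hasDerivWithinAt (hS : IsC0Semigroup S) (hG : IsGenerator G S) {x y : H}
    (hxy : (x, y) ∈ G.graph) {t : ℝ} (ht : 0 ≤ t) :
    HasDerivWithinAt (fun s : ℝ => S (max s 0) x) (S (max t 0) y) (Ioi t) t := by
  rw [hasDerivWithinAt_Ioi_iff_tendsto, max_eq_left ht]
  refine (((S t).continuous.tendsto y).comp (hG.mem_graph_iff.1 hxy)).congr' ?_
  filter_upwards [self_mem_nhdsWithin] with h hh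
  have hh : 0 ≤ h := (mem_Ioi.1 hh).le
  simp only [Function.comp_apply]
  rw [map_real_smul_clm, max_eq_left (add_nonneg ht hh), hS.apply_add ht hh, map_sub]

theorem IsC0Semigroup.sub_eq_integral (hS : IsC0Semigroup S) (hG : IsGenerator G S) {x y : H}
    (hxy : (x, y) ∈ G.graph) {t : ℝ} (ht : 0 ≤ t) :
    S t x - x = ∫ s in (0 : ℝ)..t, S (max s 0) y := by
  rw [intervalIntegral.integral_eq_sub_of_hasDeriv_right_of_le ht
    (f := fun s : ℝ => S (max s 0) x) (hS.continuous_apply x).continuousOn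
    (fun s hs => hS.hasDerivWithinAt hG hxy hs.1.le)
    ((hS.continuous_apply y).intervalIntegrable _ _)]
  rw [max_eq_left ht, max_self, hS.apply_zero]

/-- The identity `S(t)x - x = ∫₀ᵗ S(s)y ds` holds on the graph, survives limits in `(x, y)`, and
gives back membership after division by `t → 0⁺`. -/
theorem IsC0Semigroup.isClosed_graph (hS : IsC0Semigroup S) (hG : IsGenerator G S) :
    IsClosed (G.graph : Set (H × H)) := by
  refine isClosed_of_closure_subset fun p hp => ?_
  obtain ⟨u, hu, hlim⟩ := mem_closure_iff_seq_limit.1 hp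
  obtain ⟨x, y⟩ := p
  have hx : Tendsto (fun n => (u n).1) atTop (𝓝 x) := (continuous_fst.tendsto _).comp hlim
  have hy : Tendsto (fun n => (u n).2) atTop (𝓝 y) := (continuous_snd.tendsto _).comp hlim
  have key : ∀ t : ℝ, 0 ≤ t → S t x - x = ∫ s in (0 : ℝ)..t, S (max s 0) y := by
    intro t ht
    have h1 : Tendsto (fun n => S t (u n).1 - (u n).1) atTop (𝓝 (S t x - x)) :=
      (((S t).continuous.tendsto x).comp hx).sub hx
    have hcont : Continuous fun v : H => ∫ s in (0 : ℝ)..t, S (max s 0) v :=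
      intervalIntegral.continuous_parametric_intervalIntegral_of_continuous'
        (f := fun (v : H) (s : ℝ) => S (max s 0) v)
        (hS.continuous_comp continuous_snd continuous_fst) 0 t
    have h2 := (hcont.tendsto y).comp hy
    refine tendsto_nhds_unique h1 (h2.congr fun n => ?_)
    exact (hS.sub_eq_integral hG (hu n) ht).symm
  change (x, y) ∈ G.graph
  rw [hG.mem_graph_iff]
  refine (hS.tendsto_average y).congr' ?_
  filter_upwards [self_mem_nhdsWithin] with h hh
  rw [key h (mem_Ioi.1 hh).le]

end Generator

/-! ### A closed, densely defined operator equals its double adjoint. -/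

section Adjoint

variable {𝕜 H : Type*} [RCLike 𝕜] [NormedAddCommGroup H] [InnerProductSpace 𝕜 H]
  [CompleteSpace H] {G : H →ₗ.[𝕜] H}

theorem inner_eq_of_mem_graph_adjoint (hd : Dense (G.domain : Set H)) {a b y w : H}
    (hab : (a, b) ∈ G.graph) (hyw : (y, w) ∈ G.adjoint.graph) :
    inner 𝕜 y b = inner 𝕜 w a := by
  rw [LinearPMap.adjoint_graph_eq_graph_adjoint hd, Submodule.mem_adjoint_iff] at hyw
  rw [← inner_conj_symm, ← inner_conj_symm w, sub_eq_zero.1 (hyw a b hab)]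

/-- The graph is a closed subspace of the `L²` product, hence its own double orthogonal complement;
its orthogonal complement is the graph of the adjoint rotated by `90°`. -/
theorem mem_graph_of_forall_adjoint (hd : Dense (G.domain : Set H))
    (hc : IsClosed (G.graph : Set (H × H))) {a b : H}
    (h : ∀ y w, (y, w) ∈ G.adjoint.graph → inner 𝕜 y b = inner 𝕜 w a) :
    (a, b) ∈ G.graph := by
  let e := WithLp.prodContinuousLinearEquiv 2 𝕜 H H
  let K : Submodule 𝕜 (WithLp 2 (H × H)) := G.graph.comap e.toLinearMap
  have hK : IsClosed (K : Set (WithLp 2 (H × H))) := hc.preimage e.continuous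
  have : CompleteSpace K := hK.completeSpace_coe
  suffices hm : WithLp.toLp 2 (a, b) ∈ K from hm
  rw [← Submodule.orthogonal_orthogonal K, Submodule.mem_orthogonal]
  intro u hu
  rw [Submodule.mem_orthogonal] at hu
  have hg : (u.snd, -u.fst) ∈ G.adjoint.graph := by
    rw [LinearPMap.adjoint_graph_eq_graph_adjoint hd, Submodule.mem_adjoint_iff]
    intro p q hpq
    have := hu (WithLp.toLp 2 (p, q)) hpq
    rw [WithLp.prod_inner_apply] at this
    simp only [inner_neg_right, sub_neg_eq_add]
    rw [add_comm]
    exact this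
  have := h _ _ hg
  rw [WithLp.prod_inner_apply]
  rw [inner_neg_left] at this
  change inner 𝕜 u.fst a + inner 𝕜 u.snd b = 0
  rw [this]; simp

end Adjoint

/-! ### Weak differentiability of mild trajectories. -/

section Mild

variable {𝕜 H : Type*} [RCLike 𝕜] [NormedAddCommGroup H] [InnerProductSpace 𝕜 H]
  [NormedSpace ℝ H]

/-- The mild solution `S(t) x₀ + ∫₀ᵗ S(t-τ) f(τ) dτ` of `x' = G x + f`, with `S` extended by the
identity to negative times. -/
noncomputable def mildTrajectory (S : ℝ → H →L[𝕜] H) (x₀ : H) (f : ℝ → H) (t : ℝ) : H :=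
  S (max t 0) x₀ + ∫ τ in (0 : ℝ)..t, S (max (t - τ) 0) (f τ)

variable {S : ℝ → H →L[𝕜] H} {G : H →ₗ.[𝕜] H} {f : ℝ → H}

variable [CompleteSpace H]

theorem continuous_mildTrajectory (hS : IsC0Semigroup S) (hf : Continuous f) (x₀ : H) :
    Continuous (mildTrajectory S x₀ f) := by
  refine (hS.continuous_apply x₀).add ?_
  exact intervalIntegral.continuous_parametric_intervalIntegral_of_continuous
    (f := fun (t τ : ℝ) => S (max (t - τ) 0) (f τ))
    (hS.continuous_comp (by fun_prop) (by fun_prop)) continuous_id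

theorem mildTrajectory_add (hS : IsC0Semigroup S) (hf : Continuous f) (x₀ : H) {t h : ℝ}
    (ht : 0 ≤ t) (hh : 0 ≤ h) :
    mildTrajectory S x₀ f (t + h) = S h (mildTrajectory S x₀ f t) +
      ∫ r in (0 : ℝ)..h, S (max (h - r) 0) (f (t + r)) := by
  have hc : ∀ t, Continuous fun τ => S (max (t - τ) 0) (f τ) := fun t =>
    hS.continuous_comp (by fun_prop) hf
  have hi : ∀ t a b, IntervalIntegrable (fun τ => S (max (t - τ) 0) (f τ))
      MeasureTheory.volume a b := fun t a b => (hc t).intervalIntegrable a b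
  have e1 : S h (∫ τ in (0 : ℝ)..t, S (max (t - τ) 0) (f τ)) =
      ∫ τ in (0 : ℝ)..t, S (max (t + h - τ) 0) (f τ) := by
    rw [← (S h).intervalIntegral_comp_comm (hi t 0 t)]
    refine intervalIntegral.integral_congr fun τ hτ => ?_
    rw [uIcc_of_le ht] at hτ
    have h1 : 0 ≤ t - τ := sub_nonneg.2 hτ.2
    rw [max_eq_left h1, ← hS.apply_add hh h1, max_eq_left (by linarith)]
    congr 2; ring
  have e2 : ∫ r in (0 : ℝ)..h, S (max (h - r) 0) (f (t + r)) =
      ∫ τ in t..(t + h), S (max (t + h - τ) 0) (f τ) := by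
    have := intervalIntegral.integral_comp_add_left (a := 0) (b := h)
      (fun τ => S (max (t + h - τ) 0) (f τ)) t
    rw [add_zero] at this
    rw [← this]
    refine intervalIntegral.integral_congr fun r _ => ?_
    congr 3; ring
  have e3 := intervalIntegral.integral_add_adjacent_intervals (hi (t + h) 0 t) (hi (t + h) t (t + h))
  rw [mildTrajectory, mildTrajectory, map_add, e1, e2, add_assoc, e3, max_eq_left ht,
    max_eq_left (add_nonneg ht hh), add_comm t h, hS.apply_add hh ht]

variable [IsScalarTower ℝ 𝕜 H]

/-- Write `x(t + h) - x(t)` as `S(h)x(t) - x(t)` plus a Duhamel increment. The first term is the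
generator applied to `∫₀ʰ S(s)x(t) ds`, which the adjoint turns into a pairing with `w`; both
averages then converge. -/
theorem hasDerivWithinAt_inner_mildTrajectory (hS : IsC0Semigroup S) (hG : IsGenerator G S)
    (hf : Continuous f) (x₀ : H) {y w : H} (hyw : (y, w) ∈ G.adjoint.graph) {t : ℝ} (ht : 0 ≤ t) :
    HasDerivWithinAt (fun s => inner 𝕜 y (mildTrajectory S x₀ f s))
      (inner 𝕜 y (f t) + inner 𝕜 w (mildTrajectory S x₀ f t)) (Ioi t) t := by
  rw [hasDerivWithinAt_Ioi_iff_tendsto]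
  set x := mildTrajectory S x₀ f with hx
  have h1 := tendsto_average_of_continuous (k := fun p : ℝ × ℝ => S (max (p.1 - p.2) 0) (f (t + p.2)))
    (hS.continuous_comp (by fun_prop) (by fun_prop))
  simp only [add_zero, sub_zero, max_self, hS.apply_zero] at h1
  have h1' := ((innerSL 𝕜 y).continuous.tendsto _).comp h1
  have h2' := ((innerSL 𝕜 w).continuous.tendsto _).comp (hS.tendsto_average (x t))
  refine (h1'.add h2').congr' ?_
  filter_upwards [self_mem_nhdsWithin] with h hh
  have hh : 0 ≤ h := (mem_Ioi.1 hh).le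
  have e := inner_eq_of_mem_graph_adjoint (hS.dense_domain hG) (hS.integral_mem_graph hG hh (x t)) hyw
  simp only [Function.comp_apply]
  rw [map_real_smul_clm, map_real_smul_clm, ← smul_add, innerSL_apply_apply, innerSL_apply_apply, ← e,
    ← inner_add_right, hx, mildTrajectory_add hS hf x₀ ht hh, ← hx, ← inner_sub_right]
  congr 2
  abel

end Mild

/-! ### Product rule for a strongly and a weakly differentiable factor. -/

section Pairing

variable {𝕜 H : Type*} [RCLike 𝕜] [NormedAddCommGroup H] [InnerProductSpace 𝕜 H]
  [NormedSpace ℝ H] [IsScalarTower ℝ 𝕜 H]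

theorem inner_real_smul_left' (r : ℝ) (x y : H) : inner 𝕜 (r • x) y = r • inner 𝕜 x y := by
  rw [← algebraMap_smul 𝕜 r x, inner_smul_left, RCLike.real_smul_eq_coe_mul]
  simp

/-- `x` is only continuous, so the increment is split as `⟨z(t), x(t+h) - x(t)⟩ + ⟨z(t+h) - z(t),
x(t+h)⟩`: `x` is differentiated only against the frozen vector `z(t)`. -/
theorem hasDerivWithinAt_inner_of_weak {z x : ℝ → H} {z' : H} {c : 𝕜} {t : ℝ}
    (hz : HasDerivWithinAt z z' (Ioi t) t) (hx : ContinuousWithinAt x (Ioi t) t)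
    (hw : HasDerivWithinAt (fun s => inner 𝕜 (z t) (x s)) c (Ioi t) t) :
    HasDerivWithinAt (fun s => inner 𝕜 (z s) (x s)) (c + inner 𝕜 z' (x t)) (Ioi t) t := by
  rw [hasDerivWithinAt_Ioi_iff_tendsto] at hz hw ⊢
  refine (hw.add (hz.inner (𝕜 := 𝕜) (hx.tendsto.comp (tendsto_const_add_nhdsGT t)))).congr fun h => ?_
  simp only [Function.comp_apply]
  rw [inner_real_smul_left', ← smul_add, inner_sub_left]
  congr 1
  abel

end Pairing

theorem continuous_comp_max_zero {E : Type*} [TopologicalSpace E] {f : ℝ → E}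
    (hf : ContinuousOn f (Ici 0)) : Continuous fun t : ℝ => f (max t 0) :=
  hf.comp_continuous (by fun_prop) fun _ => mem_Ici.2 (le_max_right _ _)

/-! ### Uniqueness for the homogeneous weak problem. -/

section Uniqueness

variable {𝕜 H : Type*} [RCLike 𝕜] [NormedAddCommGroup H] [InnerProductSpace 𝕜 H]
  [NormedSpace ℝ H] [IsScalarTower ℝ 𝕜 H] [CompleteSpace H]
  {S : ℝ → H →L[𝕜] H} {G : H →ₗ.[𝕜] H} {Y : ℝ → H}

theorem isTestFunction_smul {φ q : ℝ → 𝕜} (hφ : ∀ t, HasDerivAt φ (q t) t) (hq : Continuous q)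
    {T : ℝ} (hφT : φ T = 0) {y w : H} (hyw : (y, w) ∈ G.adjoint.graph) :
    IsTestFunction G T (fun t => φ t • y) (fun t => φ t • w) := by
  have hcont : Continuous φ := continuous_iff_continuousAt.2 fun t => (hφ t).continuousAt
  refine ⟨?_, fun t _ => ?_, ?_, by simp [hφT]⟩
  · have h1 : ContDiff ℝ 1 φ := by
      rw [contDiff_one_iff_deriv]
      refine ⟨fun t => (hφ t).differentiableAt, ?_⟩
      rwa [show deriv φ = q from funext fun t => (hφ t).deriv]
    exact (h1.smul contDiff_const).contDiffOn
  · exact G.adjoint.graph.smul_mem (φ t) hyw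
  · exact (hcont.smul continuous_const).continuousOn

theorem inner_eq_integral_of_weak (hY : Continuous Y) {T : ℝ} (hT : 0 < T)
    (h : ∀ z w : ℝ → H, IsTestFunction G T z w →
      ∫ t in (0 : ℝ)..T, inner 𝕜 (w t + derivWithin z (Icc 0 T) t) (Y t) = 0)
    {y w : H} (hyw : (y, w) ∈ G.adjoint.graph) :
    inner 𝕜 y (Y T) = ∫ t in (0 : ℝ)..T, inner 𝕜 w (Y t) := by
  let g : ℝ → 𝕜 := fun t => inner 𝕜 y (Y t)
  let k : ℝ → 𝕜 := fun t => inner 𝕜 w (Y t)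
  have hg : Continuous g := continuous_const.inner hY
  have hk : Continuous k := continuous_const.inner hY
  let K : ℝ → 𝕜 := fun t => ∫ s in (0 : ℝ)..t, k s
  have hK : ∀ t, HasDerivAt K (k t) t := fun t => (hk.integral_hasStrictDerivAt 0 t).hasDerivAt
  have hKc : Continuous K := continuous_iff_continuousAt.2 fun t => (hK t).continuousAt
  -- `q` is the defect of the identity to be proved. Taking `φ' = q`, `φ(T) = 0` makes the weak
  -- equation, after an integration by parts, read `∫ |q|² = 0`.
  let q : ℝ → 𝕜 := fun t => g t - K t
  have hq : Continuous q := hg.sub hKc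
  let φ : ℝ → 𝕜 := fun t => ∫ s in T..t, q s
  have hφ : ∀ t, HasDerivAt φ (q t) t := fun t => (hq.integral_hasStrictDerivAt T t).hasDerivAt
  have hφc : Continuous φ := continuous_iff_continuousAt.2 fun t => (hφ t).continuousAt
  have hφT : φ T = 0 := intervalIntegral.integral_same
  have c1 : Continuous fun t => star (φ t) * k t + star (q t) * g t :=
    (hφc.star.mul hk).add (hq.star.mul hg)
  have c2 : Continuous fun t => star (q t) * K t + star (φ t) * k t :=
    (hq.star.mul hKc).add (hφc.star.mul hk)
  have c3 : Continuous fun t => star (q t) * q t := hq.star.mul hq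
  have e1 : ∫ t in (0 : ℝ)..T, (star (φ t) * k t + star (q t) * g t) = 0 := by
    rw [← h _ _ (isTestFunction_smul hφ hq hφT hyw)]
    refine intervalIntegral.integral_congr fun t ht => ?_
    rw [uIcc_of_le hT.le] at ht
    have hd : derivWithin (fun t => φ t • y) (Icc 0 T) t = q t • y :=
      ((hφ t).smul_const y).hasDerivWithinAt.derivWithin (uniqueDiffOn_Icc hT t ht)
    rw [hd, inner_add_left, inner_smul_left, inner_smul_left]
    rfl
  -- This integrates the derivative of `star φ * K`; the boundary terms vanish because `φ T = 0` and
  -- `K 0 = 0`.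
  have e2 : ∫ t in (0 : ℝ)..T, (star (q t) * K t + star (φ t) * k t) = 0 := by
    rw [intervalIntegral.integral_eq_sub_of_hasDerivAt (f := fun t => star (φ t) * K t)
      (fun t _ => (hφ t).star.mul (hK t))]
    · simp [hφT, K]
    · exact c2.intervalIntegrable _ _
  have e3 : ∫ t in (0 : ℝ)..T, (RCLike.re (star (q t) * q t)) = 0 := by
    have e : ∫ t in (0 : ℝ)..T, (star (q t) * q t) = 0 := by
      have := intervalIntegral.integral_sub
        (c1.intervalIntegrable (μ := MeasureTheory.volume) 0 T)
        (c2.intervalIntegrable (μ := MeasureTheory.volume) 0 T)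
      rw [e1, e2, sub_zero] at this
      rw [← this]
      refine intervalIntegral.integral_congr fun t _ => ?_
      simp only [q]
      ring
    have := (RCLike.reCLM (K := 𝕜)).intervalIntegral_comp_comm
      (c3.intervalIntegrable (μ := MeasureTheory.volume) 0 T)
    rw [e, map_zero] at this
    exact this
  have e4 : ∀ t, RCLike.re (star (q t) * q t) = ‖q t‖ ^ 2 := fun t => by
    rw [← starRingEnd_apply, RCLike.conj_mul, ← RCLike.ofReal_pow, RCLike.ofReal_re]
  simp only [e4] at e3
  by_contra hne
  have hpos : 0 < ∫ t in (0 : ℝ)..T, ‖q t‖ ^ 2 :=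
    intervalIntegral.integral_pos hT (hq.norm.pow 2).continuousOn (fun t _ => sq_nonneg _)
      ⟨T, ⟨hT.le, le_rfl⟩, pow_pos (norm_pos_iff.2 (sub_ne_zero.2 hne)) 2⟩
  exact hpos.ne' e3

/-- With `Z(s) = ∫₀ˢ Y`, the function `s ↦ S(t - s) Z(s)` has zero right derivative, vanishes at `0`
and equals `Z(t)` at `t`. -/
theorem integral_eq_zero_of_mem_graph (hS : IsC0Semigroup S) (hG : IsGenerator G S)
    (hY : Continuous Y) (h : ∀ t, 0 < t → (∫ s in (0 : ℝ)..t, Y s, Y t) ∈ G.graph) {t : ℝ}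
    (ht : 0 < t) : ∫ s in (0 : ℝ)..t, Y s = 0 := by
  let Z : ℝ → H := fun t => ∫ s in (0 : ℝ)..t, Y s
  have hZ : ∀ t, HasDerivAt Z (Y t) t := fun t => (hY.integral_hasStrictDerivAt 0 t).hasDerivAt
  have hZc : Continuous Z := continuous_iff_continuousAt.2 fun t => (hZ t).continuousAt
  let u : ℝ → H := fun s => S (max (t - s) 0) (Z s)
  have hu : Continuous u := hS.continuous_comp (by fun_prop) hZc
  have hd : ∀ s ∈ Ioo 0 t, HasDerivWithinAt u 0 (Ioi s) s := by
    intro s hs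
    rw [hasDerivWithinAt_Ioi_iff_tendsto]
    have h1 := hasDerivWithinAt_Ioi_iff_tendsto.1 ((hZ s).hasDerivWithinAt (s := Ioi s))
    have h2 := hG.mem_graph_iff.1 (h s hs.1)
    -- Both quotients tend to `Y s`, so `r⁻¹ (Z(s + r) - S(r) Z(s)) → 0`; applying `S(t - s - r)`
    -- yields the difference quotient of `u`.
    have h3 := h1.sub h2
    rw [sub_self] at h3
    have h4 : Tendsto (fun r : ℝ => t - s - r) (𝓝[>] 0) (𝓝 (t - s)) := by
      have : Tendsto (fun r : ℝ => t - s - r) (𝓝 0) (𝓝 (t - s - 0)) :=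
        (continuous_const.sub continuous_id).tendsto _
      rw [sub_zero] at this
      exact this.mono_left nhdsWithin_le_nhds
    have h5 := (hS.continuous_uncurry.tendsto (t - s, 0)).comp (h4.prodMk_nhds h3)
    simp only [map_zero] at h5
    refine h5.congr' ?_
    filter_upwards [Ioo_mem_nhdsGT (sub_pos.2 hs.2)] with r hr
    have hr1 : 0 ≤ t - s - r := by linarith [hr.2]
    have hr2 : 0 ≤ t - s := by linarith [hr.1]
    have e : S (max (t - s) 0) (Z s) = S (t - s - r) (S r (Z s)) := by
      rw [← hS.apply_add hr1 hr.1.le, max_eq_left hr2]; congr 2; ring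
    simp only [Function.comp_apply, u]
    rw [e, ← sub_sub t s r, max_eq_left hr1, ← smul_sub, map_real_smul_clm, ← map_sub]
    congr 2
    simp only [Z]
    abel
  have := intervalIntegral.integral_eq_sub_of_hasDeriv_right_of_le ht.le hu.continuousOn hd
    intervalIntegrable_const
  simpa [u, Z, hS.apply_zero, eq_comm] using this

theorem eq_zero_of_weak (hS : IsC0Semigroup S) (hG : IsGenerator G S)
    (hY : ContinuousOn Y (Ici 0))
    (h : ∀ T, 0 < T → ∀ z w : ℝ → H, IsTestFunction G T z w →
      ∫ t in (0 : ℝ)..T, inner 𝕜 (w t + derivWithin z (Icc 0 T) t) (Y t) = 0)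
    {t : ℝ} (ht : 0 ≤ t) : Y t = 0 := by
  have hYc := continuous_comp_max_zero hY
  have hdense := hS.dense_domain hG
  have hmem : ∀ t, 0 < t → (∫ s in (0 : ℝ)..t, Y (max s 0), Y (max t 0)) ∈ G.graph := by
    intro t ht
    refine mem_graph_of_forall_adjoint hdense (hS.isClosed_graph hG) fun y w hyw => ?_
    rw [inner_eq_integral_of_weak hYc ht (fun z w hz => ?_) hyw]
    · exact (innerSL 𝕜 w).intervalIntegral_comp_comm (hYc.intervalIntegrable _ _)
    · rw [← h t ht z w hz]
      refine intervalIntegral.integral_congr fun s hs => ?_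
      rw [uIcc_of_le ht.le] at hs
      simp only [max_eq_left hs.1]
  have hpos : EqOn Y 0 (Ioi 0) := by
    intro t ht
    have h1 := hmem t ht
    rw [integral_eq_zero_of_mem_graph hS hG hYc hmem ht, max_eq_left (mem_Ioi.1 ht).le] at h1
    exact G.graph_fst_eq_zero_snd h1 rfl
  rcases ht.eq_or_lt with rfl | ht
  -- The argument covers only `t > 0`; the value at `0` follows by right continuity.
  · have hw : Tendsto Y (𝓝[>] 0) (𝓝 (Y 0)) := (hY 0 self_mem_Ici).mono_left
      (nhdsWithin_mono _ Ioi_subset_Ici_self)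
    refine tendsto_nhds_unique hw (tendsto_const_nhds.congr' ?_)
    filter_upwards [self_mem_nhdsWithin] with s hs
    exact (hpos hs).symm
  · exact hpos ht

end Uniqueness

/-! ### Mild solutions of the boundary control system as its unique weak solutions. -/

section WeakSolution

variable {𝕜 H V : Type*} [RCLike 𝕜] [NormedAddCommGroup H] [InnerProductSpace 𝕜 H]
  [NormedAddCommGroup V] [NormedSpace 𝕜 V]
  {A : H →ₗ.[𝕜] H} {Bd : H →ₗ.[𝕜] V} {B B' : V →L[𝕜] H}

theorem IsLiftingOperator.sub_mem_graph (hB : IsLiftingOperator A Bd B)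
    (hB' : IsLiftingOperator A Bd B') (v : V) :
    (B v - B' v, A ⟨B v, hB.mem_domain v⟩ - A ⟨B' v, hB'.mem_domain v⟩) ∈
      (disturbanceFree A Bd).graph := by
  rw [mem_disturbanceFree_graph]
  refine ⟨A.graph.sub_mem (A.mem_graph ⟨B v, hB.mem_domain v⟩)
    (A.mem_graph ⟨B' v, hB'.mem_domain v⟩), ?_⟩
  obtain ⟨h1, e1⟩ := hB.boundary_comp v
  obtain ⟨h2, e2⟩ := hB'.boundary_comp v
  refine ⟨Bd.domain.sub_mem h1 h2, ?_⟩
  have := Bd.map_sub ⟨B v, h1⟩ ⟨B' v, h2⟩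
  rw [e1, e2, sub_self] at this
  exact this

variable [CompleteSpace H]

/-- Two liftings differ by a map into `D(𝒜₀)`, where the adjoint relation applies. Hence a mild
solution built from one lifting satisfies the weak identity for every other. -/
theorem IsLiftingOperator.inner_sub_inner_eq
    (hd : Dense ((disturbanceFree A Bd).domain : Set H)) (hB : IsLiftingOperator A Bd B)
    (hB' : IsLiftingOperator A Bd B') {z w : H}
    (hzw : (z, w) ∈ (disturbanceFree A Bd).adjoint.graph) (v : V) :
    inner 𝕜 w (B v) - inner 𝕜 z (A ⟨B v, hB.mem_domain v⟩) =
      inner 𝕜 w (B' v) - inner 𝕜 z (A ⟨B' v, hB'.mem_domain v⟩) := by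
  have := inner_eq_of_mem_graph_adjoint hd (hB.sub_mem_graph hB' v) hzw
  rw [inner_sub_right, inner_sub_right] at this
  linear_combination -this

variable [NormedSpace ℝ H] [IsScalarTower ℝ 𝕜 H] [NormedSpace ℝ V] [IsScalarTower ℝ 𝕜 V]
  {S : ℝ → H →L[𝕜] H} {d : ℝ → V} {U : ℝ → H}

omit [CompleteSpace H] [NormedSpace ℝ H] [IsScalarTower ℝ 𝕜 H] [IsScalarTower ℝ 𝕜 V] in
theorem continuous_forcing (hB : IsLiftingOperator A Bd B) (hd : ContDiffOn ℝ 1 d (Ici 0))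
    (hU : ContinuousOn U (Ici 0)) :
    Continuous fun t : ℝ => -B (derivWithin d (Ici 0) (max t 0)) +
      A ⟨B (d (max t 0)), hB.mem_domain _⟩ + U (max t 0) :=
  ((B.continuous.comp (continuous_comp_max_zero
    (hd.continuousOn_derivWithin (uniqueDiffOn_Ici 0) le_rfl))).neg.add
    (hB.continuous_comp.comp (continuous_comp_max_zero hd.continuousOn))).add
    (continuous_comp_max_zero hU)

omit [CompleteSpace H] [IsScalarTower ℝ 𝕜 H] [IsScalarTower ℝ 𝕜 V] in
theorem mildSolution_eq_mildTrajectory (hB : IsLiftingOperator A Bd B) (X₀ : H) {t : ℝ}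
    (ht : 0 ≤ t) :
    mildSolution hB S X₀ d U t = mildTrajectory S (X₀ - B (d 0))
      (fun t : ℝ => -B (derivWithin d (Ici 0) (max t 0)) +
        A ⟨B (d (max t 0)), hB.mem_domain _⟩ + U (max t 0)) t + B (d t) := by
  rw [mildSolution, mildTrajectory, max_eq_left ht, add_right_comm]
  congr 2
  refine intervalIntegral.integral_congr fun τ hτ => ?_
  rw [uIcc_of_le ht] at hτ
  simp only [max_eq_left hτ.1, max_eq_left (sub_nonneg.2 hτ.2)]

/-- The term `-Bḋ` in the forcing cancels the derivative of `⟨Bd, y⟩`, so `ḋ` disappears. -/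
theorem hasDerivWithinAt_inner_mildSolution (hS : IsC0Semigroup S)
    (hG : IsGenerator (disturbanceFree A Bd) S) (hB : IsLiftingOperator A Bd B)
    (hd : ContDiffOn ℝ 1 d (Ici 0)) (hU : ContinuousOn U (Ici 0)) (X₀ : H) {y w : H}
    (hyw : (y, w) ∈ (disturbanceFree A Bd).adjoint.graph) {t : ℝ} (ht : 0 ≤ t) :
    HasDerivWithinAt (fun s => inner 𝕜 y (mildSolution hB S X₀ d U s))
      (inner 𝕜 w (mildSolution hB S X₀ d U t) -
        (inner 𝕜 w (B (d t)) - inner 𝕜 y (A ⟨B (d t), hB.mem_domain (d t)⟩)) +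
        inner 𝕜 y (U t)) (Ioi t) t := by
  have hsub : Ioi t ⊆ Ici 0 := fun s hs => ht.trans (mem_Ioi.1 hs).le
  have h1 := hasDerivWithinAt_inner_mildTrajectory hS hG (continuous_forcing hB hd hU)
    (X₀ - B (d 0)) hyw ht
  have h2 : HasDerivWithinAt d (derivWithin d (Ici 0) t) (Ioi t) t :=
    ((hd.differentiableOn one_ne_zero t ht).hasDerivWithinAt).mono hsub
  have h3 : HasDerivWithinAt (fun s => inner 𝕜 y (B (d s)))
      (inner 𝕜 y (B (derivWithin d (Ici 0) t))) (Ioi t) t :=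
    (((innerSL 𝕜 y).comp B).restrictScalars ℝ).hasFDerivAt.comp_hasDerivWithinAt t h2
  refine ((h1.add h3).congr_deriv ?_).congr (fun s hs => ?_) ?_
  · rw [mildSolution_eq_mildTrajectory hB X₀ ht]
    simp only [max_eq_left ht, inner_add_right, inner_neg_right]
    ring
  · rw [mildSolution_eq_mildTrajectory hB X₀ (hsub hs), inner_add_right]; rfl
  · rw [mildSolution_eq_mildTrajectory hB X₀ ht, inner_add_right]; rfl

omit [IsScalarTower ℝ 𝕜 H] [IsScalarTower ℝ 𝕜 V] in
theorem continuousOn_mildSolution (hS : IsC0Semigroup S) (hB : IsLiftingOperator A Bd B)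
    (hd : ContDiffOn ℝ 1 d (Ici 0)) (hU : ContinuousOn U (Ici 0)) (X₀ : H) :
    ContinuousOn (mildSolution hB S X₀ d U) (Ici 0) := by
  refine ContinuousOn.congr ?_ fun t ht => mildSolution_eq_mildTrajectory hB X₀ ht
  exact (continuous_mildTrajectory hS (continuous_forcing hB hd hU) _).continuousOn.add
    (B.continuous.comp_continuousOn hd.continuousOn)

omit [CompleteSpace H] [IsScalarTower ℝ 𝕜 H] [IsScalarTower ℝ 𝕜 V] in
theorem mildSolution_zero (hS : IsC0Semigroup S) (hB : IsLiftingOperator A Bd B) (X₀ : H) :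
    mildSolution hB S X₀ d U 0 = X₀ := by
  simp [mildSolution, hS.apply_zero]

theorem isWeakSolution_mildSolution (hS : IsC0Semigroup S)
    (hG : IsGenerator (disturbanceFree A Bd) S) (hB : IsLiftingOperator A Bd B)
    (hd : ContDiffOn ℝ 1 d (Ici 0)) (hU : ContinuousOn U (Ici 0)) (X₀ : H) :
    IsWeakSolution A Bd X₀ d U (mildSolution hB S X₀ d U) := by
  refine ⟨continuousOn_mildSolution hS hB hd hU X₀, fun B' hB' T hT z w hz => ?_⟩
  set X := mildSolution hB S X₀ d U with hX
  have hsub : Icc 0 T ⊆ Ici 0 := fun s hs => hs.1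
  have hXc : ContinuousOn X (Icc 0 T) := (continuousOn_mildSolution hS hB hd hU X₀).mono hsub
  have hzc := hz.contDiffOn.continuousOn
  have hz'c := hz.contDiffOn.continuousOn_derivWithin (uniqueDiffOn_Icc hT) le_rfl
  have hdc : ContinuousOn d (Icc 0 T) := hd.continuousOn.mono hsub
  have hUc := hU.mono hsub
  have c1 : ContinuousOn (fun t => inner 𝕜 (w t + derivWithin z (Icc 0 T) t) (X t)) (Icc 0 T) :=
    (hz.continuousOn.add hz'c).inner hXc
  have c2 : ContinuousOn (fun t => inner 𝕜 (w t) (B' (d t))) (Icc 0 T) :=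
    hz.continuousOn.inner (B'.continuous.comp_continuousOn hdc)
  have c3 : ContinuousOn (fun t => inner 𝕜 (z t) (A ⟨B' (d t), hB'.mem_domain (d t)⟩))
      (Icc 0 T) := hzc.inner (hB'.continuous_comp.comp_continuousOn hdc)
  have c4 : ContinuousOn (fun t => inner 𝕜 (z t) (U t)) (Icc 0 T) := hzc.inner hUc
  have i1 := c1.intervalIntegrable_of_Icc hT.le (μ := MeasureTheory.volume)
  have i2 := c2.intervalIntegrable_of_Icc hT.le (μ := MeasureTheory.volume)
  have i3 := c3.intervalIntegrable_of_Icc hT.le (μ := MeasureTheory.volume)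
  have i4 := c4.intervalIntegrable_of_Icc hT.le (μ := MeasureTheory.volume)
  have hderiv : ∀ t ∈ Ioo 0 T, HasDerivWithinAt (fun s => inner 𝕜 (z s) (X s))
      (inner 𝕜 (w t + derivWithin z (Icc 0 T) t) (X t) - (inner 𝕜 (w t) (B' (d t)) -
        inner 𝕜 (z t) (A ⟨B' (d t), hB'.mem_domain (d t)⟩)) + inner 𝕜 (z t) (U t))
      (Ioi t) t := by
    intro t ht
    have htI : t ∈ Icc 0 T := Ioo_subset_Icc_self ht
    have h1 : HasDerivWithinAt z (derivWithin z (Icc 0 T) t) (Ioi t) t :=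
      ((hz.contDiffOn.differentiableOn one_ne_zero t htI).hasDerivWithinAt.hasDerivAt
        (Icc_mem_nhds ht.1 ht.2)).hasDerivWithinAt
    have h2 : ContinuousWithinAt X (Ioi t) t :=
      (hXc.continuousAt (Icc_mem_nhds ht.1 ht.2)).continuousWithinAt
    have h3 := hasDerivWithinAt_inner_mildSolution hS hG hB hd hU X₀ (hz.mem_graph t htI) ht.1.le
    refine (hasDerivWithinAt_inner_of_weak h1 h2 h3).congr_deriv ?_
    rw [hB.inner_sub_inner_eq (hS.dense_domain hG) hB' (hz.mem_graph t htI), inner_add_left]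
    ring
  have key := intervalIntegral.integral_eq_sub_of_hasDeriv_right_of_le hT.le (hzc.inner hXc)
    hderiv ((i1.sub (i2.sub i3)).add i4)
  rw [intervalIntegral.integral_add (i1.sub (i2.sub i3)) i4,
    intervalIntegral.integral_sub i1 (i2.sub i3), intervalIntegral.integral_sub i2 i3,
    hz.terminal, inner_zero_left, hX, mildSolution_zero hS hB, ← hX] at key
  linear_combination key

omit [NormedSpace ℝ V] [IsScalarTower ℝ 𝕜 V] in
-- The right-hand side of the weak identity depends only on the data, so it cancels in the
-- difference. One lifting is needed to have an identity at all.
theorem IsWeakSolution.eq_of_isWeakSolution (hS : IsC0Semigroup S)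
    (hG : IsGenerator (disturbanceFree A Bd) S) (hB : IsLiftingOperator A Bd B) {X₀ : H}
    {X X' : ℝ → H} (hX : IsWeakSolution A Bd X₀ d U X) (hX' : IsWeakSolution A Bd X₀ d U X')
    {t : ℝ} (ht : 0 ≤ t) : X t = X' t := by
  refine sub_eq_zero.1 (eq_zero_of_weak (Y := fun t => X t - X' t) hS hG
    (hX.continuousOn.sub hX'.continuousOn) (fun T hT z w hz => ?_) ht)
  have hc := hz.continuousOn.add
    (hz.contDiffOn.continuousOn_derivWithin (uniqueDiffOn_Icc hT) le_rfl)
  have hsub : Icc 0 T ⊆ Ici 0 := fun s hs => hs.1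
  simp only [inner_sub_right]
  rw [intervalIntegral.integral_sub
    ((hc.inner (hX.continuousOn.mono hsub)).intervalIntegrable_of_Icc hT.le)
    ((hc.inner (hX'.continuousOn.mono hsub)).intervalIntegrable_of_Icc hT.le),
    hX.weak_eq B hB T hT z w hz, hX'.weak_eq B hB T hT z w hz, sub_self]

end WeakSolution

end BoundaryControl

/-- `𝕜` is `ℝ` or `ℂ`, `H` a separable Hilbert space over `𝕜`, and the finite-dimensional normed
space `V` is `𝕜ᵐ` with an arbitrary norm. The real normed space structures on `H` and `V` are the
ones obtained by restriction of scalars. -/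
theorem mainTheorem6 {𝕜 : Type*} [RCLike 𝕜]
    {H : Type*} [NormedAddCommGroup H] [InnerProductSpace 𝕜 H] [CompleteSpace H]
    [TopologicalSpace.SeparableSpace H] [NormedSpace ℝ H] [IsScalarTower ℝ 𝕜 H]
    {V : Type*} [NormedAddCommGroup V] [NormedSpace 𝕜 V] [FiniteDimensional 𝕜 V]
    [NormedSpace ℝ V] [IsScalarTower ℝ 𝕜 V]
    (A : H →ₗ.[𝕜] H) (Bd : H →ₗ.[𝕜] V)
    (hsys : BoundaryControl.IsBoundaryControlSystem A Bd)
    (hISS : ∃ (β : ℝ → ℝ → ℝ) (γ₁ γ₂ : ℝ → ℝ), BoundaryControl.ClassKL β ∧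
      BoundaryControl.ClassK γ₁ ∧ BoundaryControl.ClassK γ₂ ∧
      BoundaryControl.ClassicalISSEstimate A Bd β γ₁ γ₂)
    (X₀ : H) (d : ℝ → V) (U : ℝ → H)
    (hd : ContDiffOn ℝ 1 d (Set.Ici 0)) (hU : ContinuousOn U (Set.Ici 0)) :
    (∃ X : ℝ → H, BoundaryControl.IsWeakSolution A Bd X₀ d U X) ∧
    ∀ X : ℝ → H, BoundaryControl.IsWeakSolution A Bd X₀ d U X →
      ∀ S : ℝ → H →L[𝕜] H, BoundaryControl.IsC0Semigroup S →
        BoundaryControl.IsGenerator (BoundaryControl.disturbanceFree A Bd) S →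
      ∀ (B : V →L[𝕜] H) (hB : BoundaryControl.IsLiftingOperator A Bd B),
      ∀ t : ℝ, 0 ≤ t → X t = BoundaryControl.mildSolution hB S X₀ d U t := by
  obtain ⟨S₀, hS₀, hG₀⟩ := hsys.exists_semigroup
  obtain ⟨B₀, hB₀⟩ := hsys.exists_lifting
  refine ⟨⟨_, BoundaryControl.isWeakSolution_mildSolution hS₀ hG₀ hB₀ hd hU X₀⟩,
    fun X hX S hS hG B hB t ht => ?_⟩
  -- The comparison uses the mild solution built from the given `S` and `B`, so independence of
  -- these choices needs no separate argument.
  exact hX.eq_of_isWeakSolution hS hG hB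
    (BoundaryControl.isWeakSolution_mildSolution hS hG hB hd hU X₀) ht
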